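/- Let $V\neq 0$ be a finite-dimensional complex Hilbert space, $d=\dim V$, and let $R\in\mathrm{End}(V\otimes V)$ be a unitary involution ($R^*R=RR^*=1$, $R^2=1$) satisfying the Yang–Baxter equation $$(R\otimes \mathrm{id}_V)(\mathrm{id}_V\otimes R)(R\otimes \mathrm{id}_V)=(\mathrm{id}_V\otimes R)(R\otimes \mathrm{id}_V)(\mathrm{id}_V\otimes R)\quad\text{in }\mathrm{End}(V^{\otimes 3}).$$ Let $S_\infty$ be the group of all bijections of $\mathbb{N}=\{1,2,\dots\}$ that move only finitely many points, with the neighbouring transpositions $\sigma_i=(i,i+1)$. Let $\mathcal{E}_0=\bigcup_n \mathrm{End}(V^{\otimes n})$ be the algebraic infinite tensor product of copies of $\mathrm{End}\,V$, i.e. the direct limit of the algebras $\mathrm{End}(V^{\otimes n})$ along the inclusions $A\mapsto A\otimes \mathrm{id}_V$, and let $\tau:\mathcal{E}_0\to\mathbb{C}$ be its normalized trace, $\tau(A)=d^{-n}\,\mathrm{Tr}_{V^{\otimes n}}(A)$ for $A\in\mathrm{End}(V^{\otimes n})$. For $i\ge 1$ put $R_i=\mathrm{id}_V^{\otimes(i-1)}\otimes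 R\otimes \mathrm{id}_V\otimes\cdots\in\mathcal{E}_0$, viewed also as an element of $\mathrm{End}(V^{\otimes n})$ for $n\ge i+1$, and let $\rho_R:\mathbb{C}[S_\infty]\to\mathcal{E}_0$ be the unique unital algebra homomorphism with $\rho_R(\sigma_i)=R_i$ for all $i$. A character of $S_\infty$ is a positive definite class function $\chi:S_\infty\to\mathbb{C}$ with $\chi(e)=1$; it is called extremal if it is an extreme point of the convex set of all characters of $S_\infty$. Then $\chi_R:=\tau\circ\rho_R$ (restricted to $S_\infty$) is an extremal character of $S_\infty$. Moreover, for every $n\geq 2$ and every $n$-cycle $c_n\in S_\infty$, $$\chi_R(c_n)=d^{-n}\,\mathrm{Tr}_{V^{\otimes n}}(R_1\cdots R_{n-1}).$$ -/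

import Mathlib

open scoped TensorProduct

namespace YangBaxter

/-! ### The infinite symmetric group -/

/-- The infinite symmetric group: all bijections of `ℕ` that move only finitely many points. -/
def SInf : Subgroup (Equiv.Perm ℕ) where
  carrier := {σ | {x | σ x ≠ x}.Finite}
  one_mem' := by simp
  mul_mem' := by
    intro a b ha hb
    refine (Set.Finite.union ha hb).subset ?_
    intro x hx
    by_contra h
    simp only [Set.mem_union, Set.mem_ofPred_eq, not_or, not_not] at h
    exact hx (by rw [Equiv.Perm.mul_apply, h.2, h.1])
  inv_mem' := by
    intro a ha
    refine Set.Finite.subset ha ?_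
    intro x hx h
    exact hx (by rw [Equiv.Perm.inv_eq_iff_eq]; exact h.symm)

/-- The neighbouring transposition exchanging `i` and `i + 1` (points are numbered from `0`). -/
def sigma (i : ℕ) : SInf :=
  ⟨Equiv.swap i (i + 1), by
    refine (Set.toFinite ({i, i + 1} : Set ℕ)).subset ?_
    intro x hx
    by_contra h
    simp only [Set.mem_insert_iff, Set.mem_singleton_iff, not_or] at h
    exact hx (Equiv.swap_apply_of_ne_of_ne h.1 h.2)⟩

/-- `c` is an `n`-cycle: a cyclic permutation moving exactly `n` points. -/
def IsNCycle (n : ℕ) (c : SInf) : Prop :=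
  (c : Equiv.Perm ℕ).IsCycle ∧ {x | (c : Equiv.Perm ℕ) x ≠ x}.ncard = n

/-! ### Characters and extremal characters -/

/-- Positive definiteness of a complex function on a group (`0 ≤ z` in `ℂ`, spelled out). -/
def IsPositiveDefinite {G : Type*} [Group G] (χ : G → ℂ) : Prop :=
  ∀ (s : Finset G) (a : G → ℂ),
    0 ≤ (∑ g ∈ s, ∑ h ∈ s, star (a g) * a h * χ (g⁻¹ * h)).re ∧
      (∑ g ∈ s, ∑ h ∈ s, star (a g) * a h * χ (g⁻¹ * h)).im = 0

/-- A (normalized) character of a discrete group: a normalized positive definite class function. -/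
structure IsCharacter {G : Type*} [Group G] (χ : G → ℂ) : Prop where
  posDef : IsPositiveDefinite χ
  classFun : ∀ g h : G, χ (h * g * h⁻¹) = χ g
  map_one : χ 1 = 1

/-- An extremal character: an extreme point of the convex set of all characters. -/
def IsExtremalCharacter {G : Type*} [Group G] (χ : G → ℂ) : Prop :=
  χ ∈ Set.extremePoints ℝ {φ : G → ℂ | IsCharacter φ}

/-! ### The presentation of the infinite symmetric group by neighbouring transpositions -/

section Presentation

variable {P : Type*} [Group P] (p : ℕ → P)

/-- The subgroup generated by the first `n` of a sequence of group elements. -/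
def genSub (n : ℕ) : Subgroup P := Subgroup.closure (p '' {i | i < n})

theorem genSub_mem {n i : ℕ} (h : i < n) : p i ∈ genSub p n :=
  Subgroup.subset_closure ⟨i, h, rfl⟩

theorem genSub_mono {m n : ℕ} (h : m ≤ n) : genSub p m ≤ genSub p n :=
  Subgroup.closure_mono (Set.image_mono fun _ hi => lt_of_lt_of_le hi h)

theorem genSub_comm (hc : ∀ i j, i + 2 ≤ j → p i * p j = p j * p i) {n j : ℕ} (h : n + 1 ≤ j)
    {x : P} (hx : x ∈ genSub p n) : x * p j = p j * x := by
  induction hx using Subgroup.closure_induction with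
  | mem x hx =>
    obtain ⟨i, hi, rfl⟩ := hx
    have hi' : i < n := hi
    exact hc i j (by omega)
  | one => simp
  | mul x y _ _ hx hy => rw [mul_assoc, hy, ← mul_assoc, hx, mul_assoc]
  | inv x _ hx => rw [inv_mul_eq_iff_eq_mul, ← mul_assoc, hx, mul_assoc, mul_inv_cancel, mul_one]

theorem genSub_succ (h2 : ∀ i, p i * p i = 1)
    (hb : ∀ i, p i * p (i + 1) * p i = p (i + 1) * p i * p (i + 1))
    (hc : ∀ i j, i + 2 ≤ j → p i * p j = p j * p i) (n : ℕ) :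
    ∀ x ∈ genSub p (n + 1),
      x ∈ genSub p n ∨ ∃ a ∈ genSub p n, ∃ b ∈ genSub p n, x = a * p n * b := by
  induction n with
  | zero =>
    intro x hx
    have key : ∀ x ∈ genSub p 1, x = 1 ∨ x = p 0 := by
      intro x hx
      induction hx using Subgroup.closure_induction with
      | mem x hx =>
        obtain ⟨i, hi, rfl⟩ := hx
        have hi' : i < 1 := hi
        obtain rfl : i = 0 := by omega
        exact Or.inr rfl
      | one => exact Or.inl rfl
      | mul x y _ _ hx hy =>
        rcases hx with rfl | rfl <;> rcases hy with rfl | rfl <;> simp [h2]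
      | inv x _ hx =>
        rcases hx with rfl | rfl
        · simp
        · exact Or.inr (inv_eq_of_mul_eq_one_right (h2 0))
    rcases key x hx with rfl | rfl
    · exact Or.inl (one_mem _)
    · exact Or.inr ⟨1, one_mem _, 1, one_mem _, by simp⟩
  | succ n ih =>
    have step : ∀ y, (y ∈ genSub p (n + 1) ∨
        ∃ a ∈ genSub p (n + 1), ∃ b ∈ genSub p (n + 1), y = a * p (n + 1) * b) →
        ∀ i, i < n + 2 → (y * p i ∈ genSub p (n + 1) ∨
          ∃ a ∈ genSub p (n + 1), ∃ b ∈ genSub p (n + 1), y * p i = a * p (n + 1) * b) := by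
      intro y hy i hi
      rcases Nat.lt_or_ge i (n + 1) with hi' | hi'
      · rcases hy with hy | ⟨a, ha, b, hb', rfl⟩
        · exact Or.inl (mul_mem hy (genSub_mem p hi'))
        · exact Or.inr ⟨a, ha, b * p i, mul_mem hb' (genSub_mem p hi'), by simp [mul_assoc]⟩
      · obtain rfl : i = n + 1 := by omega
        rcases hy with hy | ⟨a, ha, b, hb', rfl⟩
        · exact Or.inr ⟨y, hy, 1, one_mem _, by simp⟩
        · rcases ih b hb' with hbn | ⟨c, hcm, d, hd, rfl⟩
          · left
            have e : a * p (n + 1) * b * p (n + 1) = a * b := by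
              rw [mul_assoc, genSub_comm p hc le_rfl hbn, ← mul_assoc, mul_assoc a, h2, mul_one]
            rw [e]
            exact mul_mem ha (genSub_mono p (Nat.le_succ n) hbn)
          · right
            refine ⟨a * c * p n, mul_mem (mul_mem ha (genSub_mono p (Nat.le_succ n) hcm))
              (genSub_mem p (Nat.lt_succ_self n)), p n * d,
              mul_mem (genSub_mem p (Nat.lt_succ_self n)) (genSub_mono p (Nat.le_succ n) hd), ?_⟩
            have e1 := genSub_comm p hc le_rfl hcm
            have e2 := genSub_comm p hc le_rfl hd
            calc a * p (n + 1) * (c * p n * d) * p (n + 1)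
                = a * (p (n + 1) * c) * p n * (d * p (n + 1)) := by simp only [mul_assoc]
              _ = a * c * (p (n + 1) * p n * p (n + 1)) * d := by
                  rw [← e1, e2]; simp only [mul_assoc]
              _ = a * c * p n * p (n + 1) * (p n * d) := by
                  rw [← hb]; simp only [mul_assoc]
    intro x hx
    induction hx using Subgroup.closure_induction_right with
    | one => exact Or.inl (one_mem _)
    | mul_right x _ y hy ihx =>
      obtain ⟨i, hi, rfl⟩ := hy
      exact step x ihx i hi
    | mul_inv_cancel x _ y hy ihx =>
      obtain ⟨i, hi, rfl⟩ := hy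
      rw [inv_eq_of_mul_eq_one_right (h2 i)]
      exact step x ihx i hi

/-- Elements satisfying the Coxeter relations of type `A`, mapped to the neighbouring
transpositions by a homomorphism: this homomorphism is injective on the group they generate. -/
theorem genSub_injective (h2 : ∀ i, p i * p i = 1)
    (hb : ∀ i, p i * p (i + 1) * p i = p (i + 1) * p i * p (i + 1))
    (hc : ∀ i j, i + 2 ≤ j → p i * p j = p j * p i)
    (f : P →* Equiv.Perm ℕ) (hf : ∀ i, f (p i) = Equiv.swap i (i + 1)) (n : ℕ) :
    ∀ x ∈ genSub p n, f x = 1 → x = 1 := by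
  have fix : ∀ m, ∀ x ∈ genSub p m, f x (m + 1) = m + 1 := by
    intro m x hx
    induction hx using Subgroup.closure_induction with
    | mem x hx =>
      obtain ⟨i, hi, rfl⟩ := hx
      have hi' : i < m := hi
      rw [hf]
      exact Equiv.swap_apply_of_ne_of_ne (by omega) (by omega)
    | one => simp
    | mul x y _ _ hx hy => rw [map_mul, Equiv.Perm.mul_apply, hy, hx]
    | inv x _ hx => rw [map_inv, Equiv.Perm.inv_eq_iff_eq, hx]
  induction n with
  | zero =>
    intro x hx _
    have : genSub p 0 = ⊥ := by simp [genSub]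
    rw [this] at hx
    exact hx
  | succ n ih =>
    intro x hx h1
    rcases genSub_succ p h2 hb hc n x hx with hx' | ⟨a, ha, b, hb', rfl⟩
    · exact ih x hx' h1
    · exfalso
      have h3 : f (a * p n * b) (n + 1) = n + 1 := by rw [h1]; rfl
      rw [map_mul, map_mul, hf, Equiv.Perm.mul_apply, Equiv.Perm.mul_apply, fix n b hb',
        Equiv.swap_apply_right] at h3
      have h4 : f a n = f a (n + 1) := by rw [h3, fix n a ha]
      have := (f a).injective h4
      omega

theorem closure_sigma : Subgroup.closure (Set.range sigma) = ⊤ := by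
  have key : Subgroup.closure (Set.range fun i : ℕ => Equiv.swap i (i + 1)) = SInf := by
    have hS : ∀ f ∈ Set.range (fun i : ℕ => Equiv.swap i (i + 1)), f.IsSwap := by
      rintro _ ⟨i, rfl⟩
      exact ⟨i, i + 1, by omega, rfl⟩
    have h0 : ∀ x : ℕ, x ∈ MulAction.orbit
        (Subgroup.closure (Set.range fun i : ℕ => Equiv.swap i (i + 1))) (0 : ℕ) := by
      intro x
      induction x with
      | zero => exact MulAction.mem_orbit_self _
      | succ x ih =>
        have : x + 1 = (⟨Equiv.swap x (x + 1), Subgroup.subset_closure ⟨x, rfl⟩⟩ :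
          Subgroup.closure (Set.range fun i : ℕ => Equiv.swap i (i + 1))) • x := by
          change x + 1 = Equiv.swap x (x + 1) x
          rw [Equiv.swap_apply_left]
        rw [this]
        exact MulAction.mem_orbit_of_mem_orbit _ ih
    ext f
    rw [mem_closure_isSwap hS]
    constructor
    · rintro ⟨h, -⟩
      exact h
    · intro h
      refine ⟨h, fun x => ?_⟩
      rw [MulAction.orbit_eq_iff.mpr (h0 x)]
      exact h0 _
  apply Subgroup.map_injective SInf.subtype_injective
  rw [MonoidHom.map_closure, ← Set.range_comp, ← MonoidHom.range_eq_map, Subgroup.range_subtype]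
  exact key

/-- Elements of a monoid that satisfy the Coxeter relations of type `A` define a unique
representation of the infinite symmetric group. -/
theorem existsUnique_rep {M : Type*} [Monoid M] (r : ℕ → M) (h2 : ∀ i, r i * r i = 1)
    (hb : ∀ i, r i * r (i + 1) * r i = r (i + 1) * r i * r (i + 1))
    (hc : ∀ i j, i + 2 ≤ j → r i * r j = r j * r i) :
    ∃! ρ : SInf →* M, ∀ i, ρ (sigma i) = r i := by
  let u : ℕ → Mˣ := fun i => ⟨r i, r i, h2 i, h2 i⟩
  let p : ℕ → SInf × Mˣ := fun i => (sigma i, u i)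
  have s2 : ∀ i, sigma i * sigma i = 1 := fun i => Subtype.ext (Equiv.swap_mul_self _ _)
  have p2 : ∀ i, p i * p i = 1 := fun i => Prod.ext (s2 i) (Units.ext (h2 i))
  have pb : ∀ i, p i * p (i + 1) * p i = p (i + 1) * p i * p (i + 1) := by
    intro i
    refine Prod.ext (Subtype.ext ?_) (Units.ext (hb i))
    change Equiv.swap i (i + 1) * Equiv.swap (i + 1) (i + 1 + 1) * Equiv.swap i (i + 1) =
      Equiv.swap (i + 1) (i + 1 + 1) * Equiv.swap i (i + 1) * Equiv.swap (i + 1) (i + 1 + 1)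
    have e1 := Equiv.swap_mul_swap_mul_swap (x := i + 1 + 1) (y := i + 1) (z := i)
      (by omega) (by omega)
    have e2 := Equiv.swap_mul_swap_mul_swap (x := i) (y := i + 1) (z := i + 1 + 1)
      (by omega) (by omega)
    rw [Equiv.swap_comm (i + 1) i, Equiv.swap_comm (i + 1 + 1) (i + 1)] at e1
    rw [e1, e2, Equiv.swap_comm]
  have pc : ∀ i j, i + 2 ≤ j → p i * p j = p j * p i := by
    intro i j hij
    refine Prod.ext (Subtype.ext ?_) (Units.ext (hc i j hij))
    change Equiv.swap i (i + 1) * Equiv.swap j (j + 1) = Equiv.swap j (j + 1) * Equiv.swap i (i + 1)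
    refine (Equiv.Perm.Disjoint.commute ?_).eq
    intro x
    by_cases h : x = i ∨ x = i + 1
    · right
      exact Equiv.swap_apply_of_ne_of_ne (by omega) (by omega)
    · left
      exact Equiv.swap_apply_of_ne_of_ne (by omega) (by omega)
  let Γ : Subgroup (SInf × Mˣ) := Subgroup.closure (Set.range p)
  let π : Γ →* SInf := (MonoidHom.fst SInf Mˣ).comp Γ.subtype
  have memGen : ∀ x ∈ Γ, ∃ n, x ∈ genSub p n := by
    intro x hx
    induction hx using Subgroup.closure_induction with
    | mem x hx =>
      obtain ⟨i, rfl⟩ := hx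
      exact ⟨i + 1, genSub_mem p (Nat.lt_succ_self i)⟩
    | one => exact ⟨0, one_mem _⟩
    | mul x y _ _ hx hy =>
      obtain ⟨m, hm⟩ := hx
      obtain ⟨n, hn⟩ := hy
      exact ⟨max m n, mul_mem (genSub_mono p (le_max_left m n) hm)
        (genSub_mono p (le_max_right m n) hn)⟩
    | inv x _ hx =>
      obtain ⟨m, hm⟩ := hx
      exact ⟨m, inv_mem hm⟩
  have πinj : Function.Injective π := by
    rw [injective_iff_map_eq_one]
    rintro ⟨x, hx⟩ h
    obtain ⟨n, hn⟩ := memGen x hx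
    refine Subtype.ext (genSub_injective p p2 pb pc
      (SInf.subtype.comp (MonoidHom.fst SInf Mˣ)) (fun i => rfl) n x hn ?_)
    exact congrArg SInf.subtype h
  have πsurj : Function.Surjective π := by
    rw [← MonoidHom.range_eq_top, eq_top_iff, ← closure_sigma, Subgroup.closure_le]
    rintro _ ⟨i, rfl⟩
    exact ⟨⟨p i, Subgroup.subset_closure ⟨i, rfl⟩⟩, rfl⟩
  let e : Γ ≃* SInf := MulEquiv.ofBijective π ⟨πinj, πsurj⟩
  let ρ : SInf →* M := (Units.coeHom M).comp
    (((MonoidHom.snd SInf Mˣ).comp Γ.subtype).comp e.symm.toMonoidHom)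
  refine ⟨ρ, ?_, ?_⟩
  · intro i
    have : e.symm (sigma i) = ⟨p i, Subgroup.subset_closure ⟨i, rfl⟩⟩ := by
      rw [MulEquiv.symm_apply_eq]
      rfl
    change ((e.symm (sigma i)).1.2 : M) = r i
    rw [this]
  · intro ρ' h'
    have h1 : ∀ i, ρ (sigma i) = r i := by
      intro i
      have : e.symm (sigma i) = ⟨p i, Subgroup.subset_closure ⟨i, rfl⟩⟩ := by
        rw [MulEquiv.symm_apply_eq]
        rfl
      change ((e.symm (sigma i)).1.2 : M) = r i
      rw [this]
    have hU : ρ'.toHomUnits = ρ.toHomUnits := by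
      refine MonoidHom.eq_of_eqOn_dense closure_sigma ?_
      rintro _ ⟨i, rfl⟩
      exact Units.ext ((h' i).trans (h1 i).symm)
    ext g
    exact congrArg (fun f : SInf →* Mˣ => (f g : M)) hU

end Presentation

/-! ### The algebras `End(V^{⊗n})` and their union -/

section TensorAlgebra

variable (V : Type*) [AddCommGroup V] [Module ℂ V]

/-- The algebra of endomorphisms of the `n`-th tensor power of `V`. -/
abbrev TEnd (n : ℕ) : Type _ := Module.End ℂ (⨂[ℂ]^n V)

/-- The canonical identification of `V^{⊗n} ⊗ V` with `V^{⊗(n+1)}`. -/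
noncomputable def snocEquiv (n : ℕ) : (⨂[ℂ]^n V) ⊗[ℂ] V ≃ₗ[ℂ] ⨂[ℂ]^(n + 1) V :=
  (TensorProduct.congr (LinearEquiv.refl ℂ (⨂[ℂ]^n V))
    (PiTensorProduct.subsingletonEquiv (R := ℂ) (s := fun _ : Fin 1 => V) 0).symm).trans
    TensorPower.mulEquiv

/-- The canonical identification of `V^{⊗n} ⊗ (V ⊗ V)` with `V^{⊗(n+2)}`. -/
noncomputable def snocEquiv₂ (n : ℕ) : (⨂[ℂ]^n V) ⊗[ℂ] (V ⊗[ℂ] V) ≃ₗ[ℂ] ⨂[ℂ]^(n + 2) V :=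
  ((TensorProduct.assoc ℂ (⨂[ℂ]^n V) V V).symm.trans
    (TensorProduct.congr (snocEquiv V n) (LinearEquiv.refl ℂ V))).trans (snocEquiv V (n + 1))

/-- The inclusion `End(V^{⊗n}) → End(V^{⊗(n+1)})`, `A ↦ A ⊗ id_V`. -/
noncomputable def tensorId (n : ℕ) : TEnd V n →ₐ[ℂ] TEnd V (n + 1) :=
  ((snocEquiv V n).conjAlgEquiv ℂ).toAlgHom.comp
    (Module.End.rTensorAlgHom ℂ (⨂[ℂ]^n V) V)

/-- The inclusion `End(V^{⊗m}) → End(V^{⊗n})`, `A ↦ A ⊗ id_V ⊗ ⋯ ⊗ id_V`, for `m ≤ n`. -/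
noncomputable def incl (m n : ℕ) (h : m ≤ n) : TEnd V m →ₐ[ℂ] TEnd V n :=
  Nat.leRec (motive := fun n _ => TEnd V m →ₐ[ℂ] TEnd V n) (AlgHom.id ℂ (TEnd V m))
    (fun k _ f => (tensorId V k).comp f) h

theorem incl_self (n : ℕ) : incl V n n le_rfl = AlgHom.id ℂ (TEnd V n) := by
  simp [incl]

theorem incl_succ (m n : ℕ) (h : m ≤ n) :
    incl V m (n + 1) (Nat.le_succ_of_le h) = (tensorId V n).comp (incl V m n h) := by
  rw [incl, Nat.leRec_succ _ _ h, incl]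

theorem incl_incl (l m n : ℕ) (h : l ≤ m) (h' : m ≤ n) (x : TEnd V l) :
    incl V m n h' (incl V l m h x) = incl V l n (h.trans h') x := by
  induction n, h' using Nat.le_induction with
  | base => rw [incl_self]; rfl
  | succ n hmn ih =>
    rw [incl_succ V m n hmn, incl_succ V l n (h.trans hmn), AlgHom.comp_apply, AlgHom.comp_apply,
      ih]

instance : DirectedSystem (TEnd V) (fun m n h => incl V m n h) where
  map_self n x := by rw [incl_self]; rfl
  map_map l m n h h' x := incl_incl V _ _ _ h h' x

/-- The algebraic infinite tensor product of copies of `End V`: the union (direct limit) of the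
algebras `End(V^{⊗n})` along the inclusions given by tensoring with `id_V` in the last factor. -/
abbrev E0 : Type _ := DirectLimit (TEnd V) (incl V)

/-- The canonical map of `End(V^{⊗n})` into the infinite tensor product. -/
noncomputable def toE0 (n : ℕ) : TEnd V n →+* E0 V := DirectLimit.Ring.of (TEnd V) (incl V) n

theorem toE0_incl (m n : ℕ) (h : m ≤ n) (x : TEnd V m) :
    toE0 V n (incl V m n h x) = toE0 V m x :=
  DirectLimit.mk_apply m n x h

theorem trace_tensorId [FiniteDimensional ℂ V] (n : ℕ) (A : TEnd V n) :
    LinearMap.trace ℂ (⨂[ℂ]^(n + 1) V) (tensorId V n A) =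
      (Module.finrank ℂ V : ℂ) * LinearMap.trace ℂ (⨂[ℂ]^n V) A := by
  change LinearMap.trace ℂ _ ((snocEquiv V n).conj (TensorProduct.map A LinearMap.id)) = _
  rw [LinearMap.trace_conj', LinearMap.trace_tensorProduct', LinearMap.trace_id, mul_comm]

/-- The normalized trace `d⁻ⁿ Tr` on `End(V^{⊗n})`. -/
noncomputable def normTrace (n : ℕ) : TEnd V n →ₗ[ℂ] ℂ :=
  (((Module.finrank ℂ V : ℂ) ^ n)⁻¹) • LinearMap.trace ℂ (⨂[ℂ]^n V)

theorem normTrace_incl [FiniteDimensional ℂ V] [Nontrivial V] (m n : ℕ) (h : m ≤ n)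
    (A : TEnd V m) : normTrace V n (incl V m n h A) = normTrace V m A := by
  induction n, h using Nat.le_induction with
  | base => rw [incl_self]; rfl
  | succ n hmn ih =>
    have hd : (Module.finrank ℂ V : ℂ) ≠ 0 := by
      exact_mod_cast (Module.finrank_pos (R := ℂ) (M := V)).ne'
    rw [← ih, incl_succ V m n hmn, AlgHom.comp_apply]
    simp only [normTrace, LinearMap.smul_apply, trace_tensorId, smul_eq_mul]
    rw [pow_succ]
    field_simp

/-- The normalized trace `τ = ⨂ (Tr_V / d)` on the infinite tensor product: it restricts to
`d⁻ⁿ Tr` on `End(V^{⊗n})`. -/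
noncomputable def tau [FiniteDimensional ℂ V] [Nontrivial V] : E0 V →ₗ[ℂ] ℂ :=
  DirectLimit.Module.lift ℂ ℕ (TEnd V) (incl V) (normTrace V) (normTrace_incl V)

end TensorAlgebra

/-! ### The operators `R_i` -/

section Legs

variable {V : Type*} [AddCommGroup V] [Module ℂ V]

/-- The endomorphism `id_V^{⊗n} ⊗ R` of `V^{⊗(n+2)}`. -/
noncomputable def lastLegs (R : Module.End ℂ (V ⊗[ℂ] V)) (n : ℕ) : TEnd V (n + 2) :=
  (snocEquiv₂ V n).conjAlgEquiv ℂ (LinearMap.lTensor (⨂[ℂ]^n V) R)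

/-- The endomorphism `id_V^{⊗i} ⊗ R ⊗ id_V^{⊗(n-i-2)}` of `V^{⊗n}`, for `i + 2 ≤ n`. -/
noncomputable def legs (R : Module.End ℂ (V ⊗[ℂ] V)) (n i : ℕ) (h : i + 2 ≤ n) : TEnd V n :=
  incl V (i + 2) n h (lastLegs R i)

/-- The element `id_V^{⊗i} ⊗ R ⊗ id_V ⊗ ⋯` of the infinite tensor product. -/
noncomputable def legsE0 (R : Module.End ℂ (V ⊗[ℂ] V)) (i : ℕ) : E0 V :=
  toE0 V (i + 2) (lastLegs R i)

/-- The quantum Yang-Baxter equation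
`(R ⊗ id)(id ⊗ R)(R ⊗ id) = (id ⊗ R)(R ⊗ id)(id ⊗ R)` on `V ⊗ V ⊗ V`. -/
def YangBaxterEq (R : Module.End ℂ (V ⊗[ℂ] V)) : Prop :=
  let R₁ : Module.End ℂ ((V ⊗[ℂ] V) ⊗[ℂ] V) := LinearMap.rTensor V R
  let R₂ : Module.End ℂ ((V ⊗[ℂ] V) ⊗[ℂ] V) :=
    (TensorProduct.assoc ℂ V V V).symm.conj (LinearMap.lTensor V R)
  R₁ * R₂ * R₁ = R₂ * R₁ * R₂

theorem tensorId_snoc (n : ℕ) (A : TEnd V n) (x : ⨂[ℂ]^n V) (v : V) :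
    tensorId V n A (snocEquiv V n (x ⊗ₜ v)) = snocEquiv V n (A x ⊗ₜ v) := by
  change snocEquiv V n (LinearMap.rTensor V A ((snocEquiv V n).symm (snocEquiv V n (x ⊗ₜ v)))) = _
  rw [LinearEquiv.symm_apply_apply, LinearMap.rTensor_tmul]

theorem snocEquiv₂_tmul (n : ℕ) (x : ⨂[ℂ]^n V) (v w : V) :
    snocEquiv₂ V n (x ⊗ₜ (v ⊗ₜ w)) = snocEquiv V (n + 1) (snocEquiv V n (x ⊗ₜ v) ⊗ₜ w) := rfl

theorem lastLegs_snoc (R : Module.End ℂ (V ⊗[ℂ] V)) (n : ℕ) (x : ⨂[ℂ]^n V) (t : V ⊗[ℂ] V) :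
    lastLegs R n (snocEquiv₂ V n (x ⊗ₜ t)) = snocEquiv₂ V n (x ⊗ₜ R t) := by
  change snocEquiv₂ V n
    (LinearMap.lTensor _ R ((snocEquiv₂ V n).symm (snocEquiv₂ V n (x ⊗ₜ t)))) = _
  rw [LinearEquiv.symm_apply_apply, LinearMap.lTensor_tmul]

theorem lastLegs_sq (R : Module.End ℂ (V ⊗[ℂ] V)) (h : R * R = 1) (n : ℕ) :
    lastLegs R n * lastLegs R n = 1 := by
  rw [lastLegs, ← map_mul, ← LinearMap.lTensor_mul, h]
  change (snocEquiv₂ V n).conjAlgEquiv ℂ (LinearMap.lTensor _ LinearMap.id) = 1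
  rw [LinearMap.lTensor_id]
  exact map_one ((snocEquiv₂ V n).conjAlgEquiv ℂ)

theorem tensorId_tensorId_snoc₂ (n : ℕ) (A : TEnd V n) (x : ⨂[ℂ]^n V) (t : V ⊗[ℂ] V) :
    tensorId V (n + 1) (tensorId V n A) (snocEquiv₂ V n (x ⊗ₜ t)) =
      snocEquiv₂ V n (A x ⊗ₜ t) := by
  induction t using TensorProduct.induction_on with
  | zero => simp
  | tmul v w => rw [snocEquiv₂_tmul, tensorId_snoc, tensorId_snoc, snocEquiv₂_tmul]
  | add s t hs ht => simp only [TensorProduct.tmul_add, map_add, hs, ht]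

theorem lastLegs_comm (R : Module.End ℂ (V ⊗[ℂ] V)) (n : ℕ) (A : TEnd V n) :
    tensorId V (n + 1) (tensorId V n A) * lastLegs R n =
      lastLegs R n * tensorId V (n + 1) (tensorId V n A) := by
  apply LinearMap.ext
  intro y
  obtain ⟨z, rfl⟩ := (snocEquiv₂ V n).surjective y
  induction z using TensorProduct.induction_on with
  | zero => simp
  | tmul x t =>
    rw [Module.End.mul_apply, Module.End.mul_apply, lastLegs_snoc, tensorId_tensorId_snoc₂,
      tensorId_tensorId_snoc₂, lastLegs_snoc]
  | add s t hs ht => simp only [map_add, hs, ht]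

/-- The canonical identification of `V^{⊗n} ⊗ (V ⊗ V ⊗ V)` with `V^{⊗(n+3)}`. -/
noncomputable def snocEquiv₃ (V : Type*) [AddCommGroup V] [Module ℂ V] (n : ℕ) :
    (⨂[ℂ]^n V) ⊗[ℂ] ((V ⊗[ℂ] V) ⊗[ℂ] V) ≃ₗ[ℂ] ⨂[ℂ]^(n + 3) V :=
  ((TensorProduct.assoc ℂ (⨂[ℂ]^n V) (V ⊗[ℂ] V) V).symm.trans
    (TensorProduct.congr (snocEquiv₂ V n) (LinearEquiv.refl ℂ V))).trans (snocEquiv V (n + 2))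

theorem snocEquiv₃_tmul (n : ℕ) (x : ⨂[ℂ]^n V) (t : V ⊗[ℂ] V) (u : V) :
    snocEquiv₃ V n (x ⊗ₜ (t ⊗ₜ u)) = snocEquiv V (n + 2) (snocEquiv₂ V n (x ⊗ₜ t) ⊗ₜ u) := rfl

theorem snocEquiv₃_assoc (n : ℕ) (x : ⨂[ℂ]^n V) (v : V) (t : V ⊗[ℂ] V) :
    snocEquiv₃ V n (x ⊗ₜ ((TensorProduct.assoc ℂ V V V).symm (v ⊗ₜ t))) =
      snocEquiv₂ V (n + 1) (snocEquiv V n (x ⊗ₜ v) ⊗ₜ t) := by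
  induction t using TensorProduct.induction_on with
  | zero => simp
  | tmul w u => rfl
  | add s t hs ht => simp only [TensorProduct.tmul_add, map_add, hs, ht]

theorem tensorId_lastLegs (R : Module.End ℂ (V ⊗[ℂ] V)) (n : ℕ) :
    tensorId V (n + 2) (lastLegs R n) = (snocEquiv₃ V n).conjAlgEquiv ℂ
      (LinearMap.lTensor (⨂[ℂ]^n V) (LinearMap.rTensor V R)) := by
  apply LinearMap.ext
  intro y
  obtain ⟨z, rfl⟩ := (snocEquiv₃ V n).surjective y
  rw [LinearEquiv.conjAlgEquiv_apply, LinearMap.comp_apply, LinearMap.comp_apply,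
    LinearEquiv.coe_coe, LinearEquiv.coe_coe, LinearEquiv.symm_apply_apply]
  induction z using TensorProduct.induction_on with
  | zero => simp
  | tmul x s =>
    induction s using TensorProduct.induction_on with
    | zero => simp
    | tmul t u =>
      rw [snocEquiv₃_tmul, tensorId_snoc, lastLegs_snoc, LinearMap.lTensor_tmul,
        LinearMap.rTensor_tmul, snocEquiv₃_tmul]
    | add s t hs ht => simp only [TensorProduct.tmul_add, map_add, hs, ht]
  | add s t hs ht => simp only [map_add, hs, ht]

theorem lastLegs_succ (R : Module.End ℂ (V ⊗[ℂ] V)) (n : ℕ) :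
    lastLegs R (n + 1) = (snocEquiv₃ V n).conjAlgEquiv ℂ
      (LinearMap.lTensor (⨂[ℂ]^n V)
        ((TensorProduct.assoc ℂ V V V).symm.conj (LinearMap.lTensor V R))) := by
  apply LinearMap.ext
  intro y
  obtain ⟨z, rfl⟩ := (snocEquiv₃ V n).surjective y
  rw [LinearEquiv.conjAlgEquiv_apply, LinearMap.comp_apply, LinearMap.comp_apply,
    LinearEquiv.coe_coe, LinearEquiv.coe_coe, LinearEquiv.symm_apply_apply]
  induction z using TensorProduct.induction_on with
  | zero => simp
  | tmul x s =>
    obtain ⟨s, rfl⟩ := (TensorProduct.assoc ℂ V V V).symm.surjective s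
    rw [LinearMap.lTensor_tmul, LinearEquiv.conj_apply_apply, LinearEquiv.symm_apply_apply]
    induction s using TensorProduct.induction_on with
    | zero => simp
    | tmul v t =>
      rw [snocEquiv₃_assoc, lastLegs_snoc, LinearMap.lTensor_tmul, snocEquiv₃_assoc]
    | add s t hs ht => simp only [TensorProduct.tmul_add, map_add, hs, ht]
  | add s t hs ht => simp only [map_add, hs, ht]

theorem legsE0_sq (R : Module.End ℂ (V ⊗[ℂ] V)) (h : R * R = 1) (i : ℕ) :
    legsE0 R i * legsE0 R i = 1 := by
  rw [legsE0, ← map_mul, lastLegs_sq R h, map_one]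

theorem legsE0_braid (R : Module.End ℂ (V ⊗[ℂ] V)) (h : YangBaxterEq R) (i : ℕ) :
    legsE0 R i * legsE0 R (i + 1) * legsE0 R i =
      legsE0 R (i + 1) * legsE0 R i * legsE0 R (i + 1) := by
  have e : legsE0 R i = toE0 V (i + 3) (tensorId V (i + 2) (lastLegs R i)) := by
    rw [legsE0, ← toE0_incl V (i + 2) (i + 3) (Nat.le_succ _), incl_succ V _ _ le_rfl, incl_self]
    rfl
  have e' : legsE0 R (i + 1) = toE0 V (i + 3) (lastLegs R (i + 1)) := rfl
  rw [e, e', tensorId_lastLegs, lastLegs_succ]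
  simp only [← map_mul, ← LinearMap.lTensor_mul]
  have h' := h
  simp only [YangBaxterEq] at h'
  rw [h']

theorem legsE0_comm (R : Module.End ℂ (V ⊗[ℂ] V)) (i j : ℕ) (h : i + 2 ≤ j) :
    legsE0 R i * legsE0 R j = legsE0 R j * legsE0 R i := by
  have e : legsE0 R i = toE0 V (j + 2)
      (tensorId V (j + 1) (tensorId V j (incl V (i + 2) j h (lastLegs R i)))) := by
    rw [legsE0, ← toE0_incl V (i + 2) (j + 2) (by omega), incl_succ V _ (j + 1) (by omega),
      incl_succ V _ j h]
    rfl
  rw [e, legsE0, ← map_mul, lastLegs_comm, map_mul]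

end Legs

/-! ### Involutive R-matrices and their characters -/

section RMatrix

variable {V : Type*} [NormedAddCommGroup V] [InnerProductSpace ℂ V] [FiniteDimensional ℂ V]

/-- Involutive R-matrices on `V`: unitary involutive solutions of the Yang-Baxter equation. -/
structure IsInvolutiveRMatrix (R : Module.End ℂ (V ⊗[ℂ] V)) : Prop where
  unitary : R ∈ unitary (Module.End ℂ (V ⊗[ℂ] V))
  yangBaxter : YangBaxterEq R
  involutive : R * R = 1

theorem existsUnique_groupRep {R : Module.End ℂ (V ⊗[ℂ] V)} (hR : IsInvolutiveRMatrix R) :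
    ∃! ρ : SInf →* E0 V, ∀ i, ρ (sigma i) = legsE0 R i :=
  existsUnique_rep (legsE0 R) (legsE0_sq R hR.involutive) (legsE0_braid R hR.yangBaxter)
    (legsE0_comm R)

/-- The algebra homomorphism `ρ_R` from the group algebra of the infinite symmetric group to the
infinite tensor product: it is determined by `ρ_R(σ_i) = R_i`. -/
noncomputable def rho {R : Module.End ℂ (V ⊗[ℂ] V)} (hR : IsInvolutiveRMatrix R) :
    MonoidAlgebra ℂ SInf →ₐ[ℂ] E0 V :=
  MonoidAlgebra.lift ℂ (E0 V) SInf (existsUnique_groupRep hR).choose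

theorem rho_sigma {R : Module.End ℂ (V ⊗[ℂ] V)} (hR : IsInvolutiveRMatrix R) (i : ℕ) :
    rho hR (MonoidAlgebra.of ℂ SInf (sigma i)) = legsE0 R i := by
  rw [rho, MonoidAlgebra.lift_of]
  exact (existsUnique_groupRep hR).choose_spec.1 i

/-- The Yang-Baxter character `χ_R = τ ∘ ρ_R`, as a function on the group. -/
noncomputable def chi [Nontrivial V] {R : Module.End ℂ (V ⊗[ℂ] V)} (hR : IsInvolutiveRMatrix R) :
    SInf → ℂ :=
  fun σ => tau V (rho hR (MonoidAlgebra.of ℂ SInf σ))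

end RMatrix

end YangBaxter

namespace YangBaxter

/-! ### Positive definite functions and a multiplicativity criterion for extremality -/

section PositiveDefinite

variable {G : Type*} [Group G] {χ : G → ℂ}

/-! Positivity: a finite set of permutations acts through a single `TEnd V (n + 1)` by unitaries `U
g`, so `χ (g⁻¹ * h)` is a normalized `Tr (U g* U h)` and the quadratic form is a normalized `Tr (X*
X)` with `X = ∑ a g • U g` (`chi_posDef`).

Extremality: `χ` factorizes over permutations acting on separated tensor factors. Indeed, if `B`
commutes with `End(V^{⊗p})`, then `A ↦ τ (A * B)` is a tracial functional on a full matrix algebra,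
hence `τ B` times the normalized trace (`tau_mul_of_commute`). Any `g` has arbitrarily many
conjugates `u i` with separated supports. If `χ = a φ + b ψ`, Cauchy-Schwarz for `φ` and `ψ` on the
`u i` gives `N² (a |φ g|² + b |ψ g|²) ≤ ∑ χ ((u i)⁻¹ * u j) ≤ N² |χ g|² + N`. Letting `N → ∞`,
strict convexity of the squared modulus forces `φ g = ψ g` (`IsCharacter.isExtremalCharacter`).

Cycle formula: all `n`-cycles are conjugate in `SInf`, so the value may be read off at `σ_0 ⋯
σ_{n-2}`, whose image already lies in `End(V^{⊗n})`. -/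

theorem IsPositiveDefinite.sum_nonneg (h : IsPositiveDefinite χ) {ι : Type*} [Fintype ι]
    (g : ι → G) (a : ι → ℂ) :
    0 ≤ (∑ i, ∑ j, star (a i) * a j * χ ((g i)⁻¹ * g j)).re ∧
      (∑ i, ∑ j, star (a i) * a j * χ ((g i)⁻¹ * g j)).im = 0 := by
  classical
  -- `g` may repeat values, while the definition sums over a finset; coefficients are added up over
  -- each fibre of `g`.
  have key : ∀ (b : ι → ℂ) (F : G → ℂ),
      ∑ k ∈ Finset.univ.image g, (∑ i with g i = k, b i) * F k = ∑ i, b i * F (g i) := by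
    intro b F
    rw [← Finset.sum_fiberwise_of_maps_to (s := Finset.univ) (t := Finset.univ.image g) (g := g)
      (fun i hi => Finset.mem_image_of_mem g hi)]
    refine Finset.sum_congr rfl fun k _ => ?_
    rw [Finset.sum_mul]
    refine Finset.sum_congr rfl fun i hi => ?_
    rw [(Finset.mem_filter.mp hi).2]
  have e := h (Finset.univ.image g) (fun k => ∑ i with g i = k, a i)
  have e' : (∑ x ∈ Finset.univ.image g, ∑ y ∈ Finset.univ.image g,
      star (∑ i with g i = x, a i) * (∑ i with g i = y, a i) * χ (x⁻¹ * y)) =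
      ∑ i, ∑ j, star (a i) * a j * χ ((g i)⁻¹ * g j) := by
    simp only [star_sum, mul_assoc, ← Finset.mul_sum, key a]
    exact key (fun i => star (a i)) (fun x => ∑ j, a j * χ (x⁻¹ * g j))
  simpa only [e'] using e

/-- The quadratic form is real on the pair `1, g`: coefficients `(1, 1)` compare the imaginary parts
of `χ g` and `χ g⁻¹`, coefficients `(1, i)` the real parts. -/
theorem IsPositiveDefinite.map_inv (h : IsPositiveDefinite χ) (h1 : χ 1 = 1) (g : G) :
    χ g⁻¹ = star (χ g) := by
  have e := (h.sum_nonneg ![1, g] ![1, 1]).2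
  have e' := (h.sum_nonneg ![1, g] ![1, Complex.I]).2
  simp [Fin.sum_univ_two, h1] at e e'
  apply Complex.ext
  · simp
    linarith
  · simp
    linarith

/-- Cauchy-Schwarz for the average of finitely many group elements on which a positive definite
function is constant. -/
theorem IsPositiveDefinite.sq_norm_le (h : IsPositiveDefinite χ) (h1 : χ 1 = 1) {N : ℕ}
    (g : Fin N → G) (c : ℂ) (hg : ∀ i, χ (g i) = c) :
    (N : ℝ) ^ 2 * ‖c‖ ^ 2 ≤ (∑ i, ∑ j, χ ((g i)⁻¹ * g j)).re := by
  -- The coefficient `-N c` at the identity minimizes the form when every `g i` has coefficient `1`;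
  -- the minimum is the double sum minus `N² |c|²`.
  have e := (h.sum_nonneg (fun o : Option (Fin N) => o.elim 1 g)
    (fun o => o.elim (-((N : ℂ) * c)) fun _ => 1)).1
  simp only [Fintype.sum_option, Option.elim_none, Option.elim_some, inv_one, one_mul, h1, hg,
    mul_one, star_one, h.map_inv h1, Finset.sum_add_distrib, Finset.sum_const, Finset.card_univ,
    Fintype.card_fin, nsmul_eq_mul] at e
  rw [← Complex.normSq_eq_norm_sq, Complex.normSq_apply]
  simp only [Complex.re_sum]
  simp at e
  linarith

/-- Strict convexity in quantitative form: the convexity defect of the squared modulus is exactly `a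
b |z - w|²`. -/
theorem eq_of_convex_sq_norm_le {a b : ℝ} (ha : 0 < a) (hb : 0 < b) (hab : a + b = 1) (z w : ℂ)
    (h : a * ‖z‖ ^ 2 + b * ‖w‖ ^ 2 ≤ ‖(a : ℂ) * z + (b : ℂ) * w‖ ^ 2) : z = w := by
  have e : a * ‖z‖ ^ 2 + b * ‖w‖ ^ 2 - ‖(a : ℂ) * z + (b : ℂ) * w‖ ^ 2 =
      a * b * ‖z - w‖ ^ 2 := by
    obtain rfl : b = 1 - a := by linarith
    simp only [← Complex.normSq_eq_norm_sq, Complex.normSq_apply]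
    simp
    ring
  have h0 : a * b * ‖z - w‖ ^ 2 ≤ 0 := by linarith
  have h2 : ‖z - w‖ ^ 2 ≤ 0 := by
    by_contra hc
    have := mul_pos (mul_pos ha hb) (not_le.mp hc)
    linarith
  have h3 : ‖z - w‖ = 0 := by nlinarith [norm_nonneg (z - w)]
  exact sub_eq_zero.mp (norm_eq_zero.mp h3)

theorem le_of_forall_nat_sq_mul_le {x y : ℝ} (h : ∀ N : ℕ, (N : ℝ) ^ 2 * x ≤ (N : ℝ) ^ 2 * y + N) :
    x ≤ y := by
  by_contra hc
  -- The hypothesis gives `N² (x - y) ≤ N`, which fails once `N (x - y) > 1`.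
  obtain ⟨N, hN⟩ := exists_nat_gt (1 / (x - y))
  have hxy : 0 < x - y := by linarith [not_le.mp hc]
  have hN0 : (0 : ℝ) < N := lt_trans (by positivity) hN
  have h1 : 1 < N * (x - y) := by
    rwa [div_lt_iff₀ hxy] at hN
  have := h N
  nlinarith

/-- A character is extremal as soon as every element has arbitrarily many conjugates that are
pairwise independent with respect to the character. -/
theorem IsCharacter.isExtremalCharacter (h : IsCharacter χ)
    (hm : ∀ (g : G) (N : ℕ), ∃ u : Fin N → G,
      (∀ i, ∃ k, u i = k * g * k⁻¹) ∧
      ∀ i j, i ≠ j → χ ((u i)⁻¹ * u j) = χ (u i)⁻¹ * χ (u j)) :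
    IsExtremalCharacter χ := by
  refine ⟨h, ?_⟩
  rintro φ (hφ : IsCharacter φ) ψ (hψ : IsCharacter ψ) ⟨a, b, ha, hb, hab, rfl⟩
  have main : φ = ψ := by
    funext g
    refine eq_of_convex_sq_norm_le ha hb hab _ _ (le_of_forall_nat_sq_mul_le fun N => ?_)
    obtain ⟨u, hu, hu'⟩ := hm g N
    set χ : G → ℂ := a • φ + b • ψ with hχ
    have cl : ∀ {θ : G → ℂ}, IsCharacter θ → ∀ i, θ (u i) = θ g := by
      intro θ hθ i
      obtain ⟨k, hk⟩ := hu i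
      rw [hk, hθ.classFun]
    have h1 := hφ.posDef.sq_norm_le hφ.map_one u _ (cl hφ)
    have h2 := hψ.posDef.sq_norm_le hψ.map_one u _ (cl hψ)
    have e : (∑ i, ∑ j, χ ((u i)⁻¹ * u j)).re =
        a * (∑ i, ∑ j, φ ((u i)⁻¹ * u j)).re + b * (∑ i, ∑ j, ψ ((u i)⁻¹ * u j)).re := by
      simp [hχ, Finset.sum_add_distrib, Finset.mul_sum]
    have e' : (∑ i, ∑ j, χ ((u i)⁻¹ * u j)).re ≤ (N : ℝ) ^ 2 * ‖χ g‖ ^ 2 + N := by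
      -- Off the diagonal, independence gives exactly `|χ g|²`. The `N` diagonal terms equal `1` and
      -- produce the error `N`, of lower order than `N²`.
      have hle : ∀ i j, (χ ((u i)⁻¹ * u j)).re ≤ ‖χ g‖ ^ 2 + if i = j then 1 else 0 := by
        intro i j
        split_ifs with hij
        · subst hij
          rw [inv_mul_cancel, h.map_one]
          simp
        · rw [hu' i j hij, h.posDef.map_inv h.map_one, cl h, cl h, ← Complex.normSq_eq_norm_sq,
            Complex.normSq_apply]
          simp
      rw [Complex.re_sum]
      calc ∑ i, (∑ j, χ ((u i)⁻¹ * u j)).re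
          ≤ ∑ i : Fin N, ∑ j : Fin N, (‖χ g‖ ^ 2 + if i = j then 1 else 0) := by
            refine Finset.sum_le_sum fun i _ => ?_
            rw [Complex.re_sum]
            exact Finset.sum_le_sum fun j _ => hle i j
        _ = (N : ℝ) ^ 2 * ‖χ g‖ ^ 2 + N := by
            simp [Finset.sum_add_distrib]
            ring
    have e2 : χ g = (a : ℂ) * φ g + (b : ℂ) * ψ g := by simp [hχ]
    rw [← e2]
    have h1' := mul_le_mul_of_nonneg_left h1 ha.le
    have h2' := mul_le_mul_of_nonneg_left h2 hb.le
    linarith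
  rw [← main, ← add_smul, hab, one_smul]

end PositiveDefinite

/-! ### Uniqueness of the trace -/

/-- Comparing `E_ii E_ij` with `E_ij E_ii = 0` kills the off-diagonal units; comparing `E_ij E_ji`
with `E_ji E_ij` makes `f` constant on the diagonal ones. -/
theorem matrix_tracial_apply {ι : Type*} [Fintype ι] [DecidableEq ι] (f : Matrix ι ι ℂ →ₗ[ℂ] ℂ)
    (hf : ∀ A B, f (A * B) = f (B * A)) (A : Matrix ι ι ℂ) :
    (Fintype.card ι : ℂ) * f A = A.trace * f 1 := by
  have h0 : ∀ i j, i ≠ j → f (Matrix.single i j 1) = 0 := by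
    intro i j hij
    have := hf (Matrix.single i i 1) (Matrix.single i j 1)
    rw [Matrix.single_mul_single_same, Matrix.single_mul_single_of_ne (h := hij.symm)] at this
    simpa using this
  have h1 : ∀ i j, f (Matrix.single i i 1) = f (Matrix.single j j 1) := by
    intro i j
    have := hf (Matrix.single i j 1) (Matrix.single j i 1)
    rw [Matrix.single_mul_single_same, Matrix.single_mul_single_same] at this
    simpa using this
  have hA : ∀ A : Matrix ι ι ℂ, f A = ∑ i, A i i * f (Matrix.single i i 1) := by
    intro A
    conv_lhs => rw [Matrix.matrix_eq_sum_single A]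
    simp only [map_sum]
    refine Finset.sum_congr rfl fun i _ => ?_
    have hs : ∀ j, Matrix.single i j (A i j) = A i j • Matrix.single i j (1 : ℂ) := by
      intro j
      rw [Matrix.smul_single, smul_eq_mul, mul_one]
    rw [Finset.sum_eq_single i]
    · rw [hs, map_smul, smul_eq_mul]
    · intro j _ hj
      rw [hs, map_smul, h0 i j hj.symm, smul_zero]
    · simp
  rw [hA A, hA 1, Matrix.trace, Finset.mul_sum, Finset.sum_mul]
  refine Finset.sum_congr rfl fun i _ => ?_
  have : ∑ j, (1 : Matrix ι ι ℂ) j j * f (Matrix.single j j 1) =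
      Fintype.card ι * f (Matrix.single i i 1) := by
    simp [h1 _ i]
  rw [this, Matrix.diag_apply]
  ring

theorem end_tracial_apply {W : Type*} [AddCommGroup W] [Module ℂ W] [FiniteDimensional ℂ W]
    (f : Module.End ℂ W →ₗ[ℂ] ℂ) (hf : ∀ A B, f (A * B) = f (B * A)) (A : Module.End ℂ W) :
    (Module.finrank ℂ W : ℂ) * f A = LinearMap.trace ℂ W A * f 1 := by
  let b := Module.finBasis ℂ W
  have h := matrix_tracial_apply (f ∘ₗ (LinearMap.toMatrixAlgEquiv b).symm.toLinearMap)
    (fun A B => by simp [hf]) (LinearMap.toMatrixAlgEquiv b A)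
  rw [LinearMap.trace_eq_matrix_trace ℂ b,
    show LinearMap.toMatrix b b A = LinearMap.toMatrixAlgEquiv b A from rfl]
  simpa using h

/-! ### Endomorphisms with unitary matrix -/

section UnitaryIn

open scoped Kronecker

variable {W X Y : Type*} [AddCommGroup W] [Module ℂ W] [AddCommGroup X] [Module ℂ X]
  [AddCommGroup Y] [Module ℂ Y] {ι κ : Type*} [Fintype ι] [DecidableEq ι] [Fintype κ]
  [DecidableEq κ]

/-- The endomorphisms whose matrix in the given basis is unitary. -/
noncomputable def unitaryIn (c : Module.Basis ι ℂ W) : Submonoid (Module.End ℂ W) :=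
  (Matrix.unitaryGroup ι ℂ).comap (LinearMap.toMatrixAlgEquiv c)

theorem mem_unitaryIn {c : Module.Basis ι ℂ W} {A : Module.End ℂ W} :
    A ∈ unitaryIn c ↔ LinearMap.toMatrix c c A ∈ Matrix.unitaryGroup ι ℂ := Iff.rfl

theorem conj_mem_unitaryIn {c : Module.Basis ι ℂ W} {A : Module.End ℂ W} (h : A ∈ unitaryIn c)
    (L : W ≃ₗ[ℂ] X) : L.conj A ∈ unitaryIn (c.map L) := by
  rw [mem_unitaryIn] at *
  convert h using 1
  ext i j
  simp [LinearMap.toMatrix_apply]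

theorem mem_unitaryIn_reindex {c : Module.Basis ι ℂ W} {A : Module.End ℂ W} (h : A ∈ unitaryIn c)
    (e : ι ≃ κ) : A ∈ unitaryIn (c.reindex e) := by
  rw [mem_unitaryIn] at *
  have : LinearMap.toMatrix (c.reindex e) (c.reindex e) A =
      Matrix.reindexAlgEquiv ℂ ℂ e (LinearMap.toMatrix c c A) := by
    ext i j
    simp [LinearMap.toMatrix_apply]
  rw [this, Matrix.mem_unitaryGroup_iff]
  have h' := (Matrix.mem_unitaryGroup_iff.mp h)
  have hs : star (Matrix.reindexAlgEquiv ℂ ℂ e (LinearMap.toMatrix c c A)) =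
      Matrix.reindexAlgEquiv ℂ ℂ e (star (LinearMap.toMatrix c c A)) := by
    ext i j
    simp
  rw [hs, ← map_mul, h', map_one]

theorem map_mem_unitaryIn {c : Module.Basis ι ℂ W} {A : Module.End ℂ W} (hA : A ∈ unitaryIn c)
    {e : Module.Basis κ ℂ X} {B : Module.End ℂ X} (hB : B ∈ unitaryIn e) :
    TensorProduct.map A B ∈ unitaryIn (c.tensorProduct e) := by
  rw [mem_unitaryIn, TensorProduct.toMatrix_map]
  exact Matrix.kronecker_mem_unitary hA hB

/-- The inverse plays the role of the adjoint: its matrix is the conjugate transpose, so no inner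
product on `W` is needed. -/
theorem exists_inverse_of_mem_unitaryIn {c : Module.Basis ι ℂ W} {A : Module.End ℂ W}
    (h : A ∈ unitaryIn c) : ∃ B ∈ unitaryIn c, A * B = 1 ∧ B * A = 1 ∧
      LinearMap.toMatrixAlgEquiv c B = star (LinearMap.toMatrixAlgEquiv c A) := by
  have hi : ∀ M, LinearMap.toMatrixAlgEquiv c ((LinearMap.toMatrixAlgEquiv c).symm M) = M :=
    (LinearMap.toMatrixAlgEquiv c).apply_symm_apply
  refine ⟨(LinearMap.toMatrixAlgEquiv c).symm (star (LinearMap.toMatrixAlgEquiv c A)),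
    ?_, ?_, ?_, hi _⟩
  · change LinearMap.toMatrixAlgEquiv c _ ∈ Matrix.unitaryGroup ι ℂ
    rw [hi]
    exact Unitary.star_mem h
  · apply (LinearMap.toMatrixAlgEquiv c).injective
    rw [map_mul, hi, map_one]
    exact Matrix.mem_unitaryGroup_iff.mp h
  · apply (LinearMap.toMatrixAlgEquiv c).injective
    rw [map_mul, hi, map_one]
    exact Matrix.mem_unitaryGroup_iff'.mp h

end UnitaryIn

/-! ### Product bases of tensor powers and unitarity of the operators `R_i` -/

section TensorBasis

variable {V : Type*} [AddCommGroup V] [Module ℂ V] {d : ℕ}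

/-- The basis of `V^{⊗n}` induced by a basis of `V`. -/
noncomputable def tensorBasis (b : Module.Basis (Fin d) ℂ V) :
    (n : ℕ) → Module.Basis (Fin (d ^ n)) ℂ (⨂[ℂ]^n V)
  | 0 => (Module.Basis.singleton (Fin 1) ℂ).map (PiTensorProduct.isEmptyEquiv (Fin 0)).symm
  | n + 1 => (((tensorBasis b n).tensorProduct b).reindex finProdFinEquiv).map (snocEquiv V n)

theorem tensorBasis_succ_apply (b : Module.Basis (Fin d) ℂ V) (n : ℕ) (i : Fin (d ^ n))
    (j : Fin d) : tensorBasis b (n + 1) (finProdFinEquiv (i, j) : Fin (d ^ n * d)) =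
      snocEquiv V n (tensorBasis b n i ⊗ₜ b j) := by
  change (((tensorBasis b n).tensorProduct b).reindex finProdFinEquiv).map (snocEquiv V n)
    (finProdFinEquiv (i, j)) = _
  simp

theorem tensorId_mem_unitaryIn (b : Module.Basis (Fin d) ℂ V) {n : ℕ} {A : TEnd V n}
    (h : A ∈ unitaryIn (tensorBasis b n)) : tensorId V n A ∈ unitaryIn (tensorBasis b (n + 1)) :=
  conj_mem_unitaryIn (mem_unitaryIn_reindex
    (map_mem_unitaryIn h (one_mem (unitaryIn b))) finProdFinEquiv) (snocEquiv V n)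

theorem incl_mem_unitaryIn (b : Module.Basis (Fin d) ℂ V) {m n : ℕ} (hmn : m ≤ n) {A : TEnd V m}
    (h : A ∈ unitaryIn (tensorBasis b m)) : incl V m n hmn A ∈ unitaryIn (tensorBasis b n) := by
  induction n, hmn using Nat.le_induction with
  | base => rwa [incl_self]
  | succ n hmn ih =>
    rw [incl_succ V m n hmn]
    exact tensorId_mem_unitaryIn b ih

theorem lastLegs_mem_unitaryIn (b : Module.Basis (Fin d) ℂ V) {R : Module.End ℂ (V ⊗[ℂ] V)}
    (h : R ∈ unitaryIn (b.tensorProduct b)) (n : ℕ) :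
    lastLegs R n ∈ unitaryIn (tensorBasis b (n + 2)) := by
  have e := conj_mem_unitaryIn (mem_unitaryIn_reindex
    (map_mem_unitaryIn (one_mem (unitaryIn (tensorBasis b n))) h)
    (((Equiv.prodAssoc _ _ _).symm.trans
      (finProdFinEquiv.prodCongr (Equiv.refl _))).trans finProdFinEquiv)) (snocEquiv₂ V n)
  -- `snocEquiv₂` appends two factors at once, `tensorBasis` one at a time; reassociating the
  -- indices makes the two bases agree.
  have hb : (((tensorBasis b n).tensorProduct (b.tensorProduct b)).reindex
      (((Equiv.prodAssoc _ _ _).symm.trans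
      (finProdFinEquiv.prodCongr (Equiv.refl _))).trans finProdFinEquiv)).map (snocEquiv₂ V n) =
      tensorBasis b (n + 2) := by
    refine Module.Basis.eq_of_apply_eq fun i => ?_
    obtain ⟨⟨i, k⟩, rfl⟩ := finProdFinEquiv.surjective i
    obtain ⟨⟨i, j⟩, rfl⟩ := finProdFinEquiv.surjective i
    have e₁ := tensorBasis_succ_apply b (n + 1) (finProdFinEquiv (i, j) : Fin (d ^ n * d)) k
    rw [tensorBasis_succ_apply] at e₁
    refine Eq.trans ?_ e₁.symm
    simp [snocEquiv₂_tmul]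
  rw [hb] at e
  exact e

end TensorBasis

/-- In an orthonormal basis, taking matrices is a star homomorphism. Only here does unitarity of `R`
enter. -/
theorem IsInvolutiveRMatrix.mem_unitaryIn {V : Type*} [NormedAddCommGroup V]
    [InnerProductSpace ℂ V] [FiniteDimensional ℂ V] {R : Module.End ℂ (V ⊗[ℂ] V)}
    (hR : IsInvolutiveRMatrix R) {d : ℕ} (b : OrthonormalBasis (Fin d) ℂ V) :
    R ∈ unitaryIn (b.toBasis.tensorProduct b.toBasis) := by
  have h := Unitary.map_mem (LinearMap.toMatrixOrthonormal (b.tensorProduct b)) hR.unitary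
  rw [← OrthonormalBasis.toBasis_tensorProduct]
  exact h

/-! ### Cycles are conjugate in the infinite symmetric group -/

theorem SInf.exists_bound (c : SInf) : ∃ M, ∀ x, M ≤ x → (c : Equiv.Perm ℕ) x = x := by
  obtain ⟨M, hM⟩ := (show {x | (c : Equiv.Perm ℕ) x ≠ x}.Finite from c.2).bddAbove
  refine ⟨M + 1, fun x hx => ?_⟩
  by_contra h
  have := hM h
  omega

/-- A finitary permutation is the extension of a permutation of an initial segment. -/
theorem SInf.exists_ofSubtype (c : SInf) {M : ℕ} (h : ∀ x, M ≤ x → (c : Equiv.Perm ℕ) x = x) :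
    ∃ c' : Equiv.Perm {x // x ∈ Finset.range M}, Equiv.Perm.ofSubtype c' = (c : Equiv.Perm ℕ) := by
  have h1 : ∀ x, (c : Equiv.Perm ℕ) x ∈ Finset.range M ↔ x ∈ Finset.range M := by
    intro x
    simp only [Finset.mem_range]
    rcases lt_or_ge x M with hx | hx
    · refine ⟨fun _ => hx, fun _ => ?_⟩
      by_contra hc
      have := (c : Equiv.Perm ℕ).injective (h _ (not_lt.mp hc))
      omega
    · rw [h x hx]
  refine ⟨(c : Equiv.Perm ℕ).subtypePerm h1, ?_⟩
  apply Equiv.Perm.ofSubtype_subtypePerm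
  intro x hx
  by_contra hc
  exact hx (h x (by simpa using hc))

theorem ofSubtype_mem_SInf {M : ℕ} (c : Equiv.Perm {x // x ∈ Finset.range M}) :
    Equiv.Perm.ofSubtype c ∈ SInf := by
  refine (Finset.range M).finite_toSet.subset fun x hx => ?_
  by_contra h
  exact hx (Equiv.Perm.ofSubtype_apply_of_not_mem c h)

theorem isCycle_of_ofSubtype {M : ℕ} {c : Equiv.Perm {x // x ∈ Finset.range M}}
    (h : (Equiv.Perm.ofSubtype c).IsCycle) : c.IsCycle := by
  obtain ⟨x, hx, hy⟩ := h
  have hxM : x ∈ Finset.range M := by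
    by_contra hc
    exact hx (Equiv.Perm.ofSubtype_apply_of_not_mem c hc)
  refine ⟨⟨x, hxM⟩, fun hc => hx ?_, fun y hyc => ?_⟩
  · rw [Equiv.Perm.ofSubtype_apply_of_mem c hxM, hc]
  · obtain ⟨k, hk⟩ := hy (y := y) (by
      rw [Equiv.Perm.ofSubtype_apply_coe]
      exact fun hc => hyc (Subtype.ext hc))
    refine ⟨k, Subtype.ext ?_⟩
    rw [← map_zpow, Equiv.Perm.ofSubtype_apply_of_mem (c ^ k) hxM] at hk
    exact hk

theorem card_support_of_ofSubtype {M : ℕ} (c : Equiv.Perm {x // x ∈ Finset.range M}) :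
    {x | Equiv.Perm.ofSubtype c x ≠ x}.ncard = c.support.card := by
  rw [← Set.ncard_coe_finset, ← Set.ncard_image_of_injective _ Subtype.val_injective]
  congr 1
  ext x
  simp only [Set.mem_image, Finset.mem_coe, Equiv.Perm.mem_support]
  constructor
  · intro hx
    have hxM : x ∈ Finset.range M := by
      by_contra hc
      exact hx (Equiv.Perm.ofSubtype_apply_of_not_mem c hc)
    refine ⟨⟨x, hxM⟩, fun hc => hx ?_, rfl⟩
    rw [Equiv.Perm.ofSubtype_apply_of_mem c hxM, hc]
  · rintro ⟨y, hy, rfl⟩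
    change Equiv.Perm.ofSubtype c y ≠ y
    rw [Equiv.Perm.ofSubtype_apply_coe]
    exact fun hc => hy (Subtype.ext hc)

/-- Both cycles live on a common initial segment, where supports of equal size give conjugacy;
extending the conjugator by the identity keeps it finitary. -/
theorem IsNCycle.exists_conj {n : ℕ} {c d : SInf} (hc : IsNCycle n c) (hd : IsNCycle n d) :
    ∃ k : SInf, d = k * c * k⁻¹ := by
  obtain ⟨M₁, h₁⟩ := SInf.exists_bound c
  obtain ⟨M₂, h₂⟩ := SInf.exists_bound d
  obtain ⟨c', hc'⟩ := SInf.exists_ofSubtype c (M := max M₁ M₂)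
    fun x hx => h₁ x (le_trans (le_max_left _ _) hx)
  obtain ⟨d', hd'⟩ := SInf.exists_ofSubtype d (M := max M₁ M₂)
    fun x hx => h₂ x (le_trans (le_max_right _ _) hx)
  obtain ⟨hc1, hc2⟩ := hc
  obtain ⟨hd1, hd2⟩ := hd
  rw [← hc'] at hc1 hc2
  rw [← hd'] at hd1 hd2
  rw [card_support_of_ofSubtype] at hc2 hd2
  obtain ⟨k, hk⟩ := isConj_iff.mp
    ((isCycle_of_ofSubtype hc1).isConj (isCycle_of_ofSubtype hd1) (hc2.trans hd2.symm))
  refine ⟨⟨Equiv.Perm.ofSubtype k, ofSubtype_mem_SInf k⟩, Subtype.ext ?_⟩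
  change (d : Equiv.Perm ℕ) = Equiv.Perm.ofSubtype k * c * (Equiv.Perm.ofSubtype k)⁻¹
  rw [← hc', ← hd', ← hk, map_mul, map_mul, map_inv]

theorem prod_swap_eq_formPerm (a n : ℕ) :
    ((List.range' a n).map fun i => Equiv.swap i (i + 1)).prod =
      (List.range' a (n + 1)).formPerm := by
  induction n generalizing a with
  | zero => simp
  | succ n ih =>
    rw [List.range'_succ, List.map_cons, List.prod_cons, ih, List.range'_succ (n := n + 1),
      List.range'_succ (n := n), List.formPerm_cons_cons]

theorem isNCycle_prod_sigma {n : ℕ} (hn : 2 ≤ n) :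
    IsNCycle n ((List.range' 0 (n - 1)).map sigma).prod := by
  have e : ((((List.range' 0 (n - 1)).map sigma).prod : SInf) : Equiv.Perm ℕ) =
      (List.range' 0 n).formPerm := by
    rw [SInf.coe_list_prod, List.map_map]
    have := prod_swap_eq_formPerm 0 (n - 1)
    rw [Nat.sub_add_cancel (by omega)] at this
    exact this
  have hl : (List.range' 0 n).length = n := List.length_range'
  have hd : (List.range' 0 n).Nodup := List.nodup_range'
  refine ⟨?_, ?_⟩
  · rw [e]
    exact List.isCycle_formPerm hd (by omega)
  · rw [e, List.support_formPerm_of_nodup' _ hd, Set.ncard_coe_finset,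
      List.toFinset_card_of_nodup hd, hl]
    -- `formPerm` of a one-element list has empty support; `n ≥ 2` rules this case out.
    intro x hx
    rw [hx] at hl
    simp at hl
    omega

/-! ### The normalized trace on the infinite tensor product -/

section Tau

variable (V : Type*) [AddCommGroup V] [Module ℂ V]

theorem toE0_smul (n : ℕ) (z : ℂ) (A : TEnd V n) : toE0 V n (z • A) = z • toE0 V n A := rfl

theorem exists_toE0_eq (x : E0 V) : ∃ n A, toE0 V n A = x := by
  induction x using DirectLimit.induction with
  | _ n A => exact ⟨n, A, rfl⟩

variable [FiniteDimensional ℂ V] [Nontrivial V]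

theorem tau_toE0 (n : ℕ) (A : TEnd V n) : tau V (toE0 V n A) = normTrace V n A := rfl

theorem tau_mul_comm (x y : E0 V) : tau V (x * y) = tau V (y * x) := by
  obtain ⟨m, A, rfl⟩ := exists_toE0_eq V x
  obtain ⟨n, B, rfl⟩ := exists_toE0_eq V y
  rw [← toE0_incl V m (max m n) (le_max_left _ _) A, ← toE0_incl V n (max m n) (le_max_right _ _) B,
    ← map_mul, ← map_mul, tau_toE0, tau_toE0, normTrace, LinearMap.smul_apply, LinearMap.smul_apply,
    LinearMap.trace_mul_comm]

theorem tau_one : tau V 1 = 1 := by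
  have h : LinearMap.trace ℂ (⨂[ℂ]^0 V) 1 = 1 := by
    rw [LinearMap.trace_one]
    have := (PiTensorProduct.isEmptyEquiv (R := ℂ) (s := fun _ : Fin 0 => V) (Fin 0)).finrank_eq
    rw [this]
    simp
  rw [← map_one (toE0 V 0), tau_toE0, normTrace, LinearMap.smul_apply, h]
  simp

/-- The normalized trace is multiplicative on products with elements of the relative commutant
of `End(V^{⊗p})`. -/
theorem tau_mul_of_commute {p : ℕ} (B : E0 V) (hB : ∀ A, toE0 V p A * B = B * toE0 V p A)
    (A : TEnd V p) : tau V (toE0 V p A * B) = tau V (toE0 V p A) * tau V B := by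
  let f : TEnd V p →ₗ[ℂ] ℂ :=
    { toFun := fun A => tau V (toE0 V p A * B)
      map_add' := fun A A' => by rw [map_add, add_mul, map_add]
      map_smul' := fun z A => by rw [toE0_smul, smul_mul_assoc, map_smul, RingHom.id_apply] }
  -- Since `B` commutes with `A'`, `τ (A A' B) = τ (A B A') = τ (A' A B)`.
  have hf : ∀ A A', f (A * A') = f (A' * A) := by
    intro A A'
    change tau V (toE0 V p (A * A') * B) = tau V (toE0 V p (A' * A) * B)
    rw [map_mul (toE0 V p), map_mul (toE0 V p), mul_assoc, hB, ← mul_assoc, tau_mul_comm, ← mul_assoc]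
  have h1 := end_tracial_apply f hf A
  have h2 := end_tracial_apply (normTrace V p) (fun A A' => by
    rw [normTrace, LinearMap.smul_apply, LinearMap.smul_apply, LinearMap.trace_mul_comm]) A
  have h3 : normTrace V p 1 = 1 := by rw [← tau_toE0, map_one, tau_one]
  have h4 : f 1 = tau V B := by
    change tau V (toE0 V p 1 * B) = _
    rw [map_one, one_mul]
  -- A zero dimension would make the normalized trace of `1` vanish.
  have hd : (Module.finrank ℂ (⨂[ℂ]^p V) : ℂ) ≠ 0 := by
    intro h0
    have : LinearMap.trace ℂ (⨂[ℂ]^p V) 1 = 0 := by rw [LinearMap.trace_one, h0]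
    rw [normTrace, LinearMap.smul_apply, this, smul_zero] at h3
    exact zero_ne_one h3
  change f A = normTrace V p A * tau V B
  rw [h4] at h1
  rw [h3, mul_one] at h2
  apply mul_left_cancel₀ hd
  rw [h1, ← mul_assoc, h2]

end Tau

/-! ### Translates of permutations -/

theorem mem_genSub_sigma (g : SInf) : ∃ n, g ∈ genSub sigma n := by
  have hg : g ∈ Subgroup.closure (Set.range sigma) := by
    rw [closure_sigma]
    exact Subgroup.mem_top g
  induction hg using Subgroup.closure_induction with
  | mem x hx =>
    obtain ⟨i, rfl⟩ := hx
    exact ⟨i + 1, genSub_mem sigma (Nat.lt_succ_self i)⟩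
  | one => exact ⟨0, one_mem _⟩
  | mul x y _ _ hx hy =>
    obtain ⟨m, hm⟩ := hx
    obtain ⟨n, hn⟩ := hy
    exact ⟨max m n, mul_mem (genSub_mono sigma (le_max_left m n) hm)
      (genSub_mono sigma (le_max_right m n) hn)⟩
  | inv x _ hx =>
    obtain ⟨m, hm⟩ := hx
    exact ⟨m, inv_mem hm⟩

/-- A finitary permutation that translates the initial segment `{0, …, m}` by `s`. -/
theorem exists_translation {m s : ℕ} (h : m < s) :
    ∃ θ : SInf, ∀ x ≤ m, (θ : Equiv.Perm ℕ) x = x + s := by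
  -- Exchange the blocks `[0, m]` and `[s, s + m]`, which are disjoint because `m < s`.
  let f : ℕ → ℕ := fun x => if x ≤ m then x + s else if s ≤ x ∧ x ≤ s + m then x - s else x
  have hf : Function.Involutive f := by
    intro x
    simp only [f]
    split_ifs <;> omega
  refine ⟨⟨hf.toPerm, ?_⟩, fun x hx => ?_⟩
  · refine (Set.finite_Iic (s + m)).subset fun x hx => ?_
    by_contra hc
    rw [Set.mem_Iic, not_le] at hc
    refine hx ?_
    change f x = x
    simp only [f]
    rw [if_neg (by omega), if_neg (by omega)]
  · change f x = x + s
    simp only [f, if_pos hx]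

/-- The subgroup generated by the neighbouring transpositions with index in `[s, s + m)`. -/
def windowSub (s m : ℕ) : Subgroup SInf := Subgroup.closure (sigma '' {i | s ≤ i ∧ i < s + m})

/-- For `i < m` both `i` and `i + 1` are translated by `θ`, so conjugation by `θ` sends `σ_i` to
`σ_{i+s}`. -/
theorem exists_conj_mem_windowSub {m s : ℕ} (h : m < s) {g : SInf} (hg : g ∈ genSub sigma m) :
    ∃ k, k * g * k⁻¹ ∈ windowSub s m := by
  obtain ⟨θ, hθ⟩ := exists_translation h
  refine ⟨θ, ?_⟩
  have : genSub sigma m ≤ (windowSub s m).comap (MulAut.conj θ).toMonoidHom := by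
    rw [genSub, Subgroup.closure_le]
    rintro _ ⟨i, hi, rfl⟩
    have hi' : i < m := hi
    have e : θ * sigma i * θ⁻¹ = sigma (i + s) := by
      refine Subtype.ext ?_
      change (θ : Equiv.Perm ℕ) * Equiv.swap i (i + 1) * (θ : Equiv.Perm ℕ)⁻¹ = _
      rw [← Equiv.swap_apply_apply, hθ i hi'.le, hθ (i + 1) hi', Nat.add_right_comm]
      rfl
    change θ * sigma i * θ⁻¹ ∈ windowSub s m
    rw [e]
    exact Subgroup.subset_closure ⟨i + s, ⟨by omega, by omega⟩, rfl⟩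
  exact this hg

/-! ### The Yang-Baxter characters -/

section Legs

variable {V : Type*} [AddCommGroup V] [Module ℂ V]

theorem toE0_legs (R : Module.End ℂ (V ⊗[ℂ] V)) (n i : ℕ) (h : i + 2 ≤ n) :
    toE0 V n (legs R n i h) = legsE0 R i :=
  toE0_incl V _ _ h _

/-- The two operators act on disjoint tensor factors: `A` on those below `p`, `R_j` on `j` and `j +
1`. -/
theorem toE0_comm_legsE0 (R : Module.End ℂ (V ⊗[ℂ] V)) {p j : ℕ} (h : p ≤ j) (A : TEnd V p) :
    toE0 V p A * legsE0 R j = legsE0 R j * toE0 V p A := by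
  have e : toE0 V p A = toE0 V (j + 2) (tensorId V (j + 1) (tensorId V j (incl V p j h A))) := by
    rw [← toE0_incl V p (j + 2) (by omega), incl_succ V _ (j + 1) (by omega), incl_succ V _ j h]
    rfl
  rw [e, legsE0, ← map_mul, lastLegs_comm, map_mul]

end Legs

/-! ### Locality, positivity and extremality of `χ_R` -/

section Chi

variable {V : Type*} [NormedAddCommGroup V] [InnerProductSpace ℂ V] [FiniteDimensional ℂ V]
  {R : Module.End ℂ (V ⊗[ℂ] V)}

/-- The restriction of `ρ_R` to the group. -/
noncomputable def groupRep (hR : IsInvolutiveRMatrix R) : SInf →* E0 V :=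
  (existsUnique_groupRep hR).choose

theorem groupRep_sigma (hR : IsInvolutiveRMatrix R) (i : ℕ) :
    groupRep hR (sigma i) = legsE0 R i :=
  (existsUnique_groupRep hR).choose_spec.1 i

/-- The generators `σ_i` with `i < n` touch only the factors `0, …, n`, hence the exponent `n + 1`.
-/
theorem exists_unitary_groupRep (hR : IsInvolutiveRMatrix R) {d : ℕ}
    (b : OrthonormalBasis (Fin d) ℂ V) {n : ℕ} {g : SInf} (hg : g ∈ genSub sigma n) :
    ∃ U ∈ unitaryIn (tensorBasis b.toBasis (n + 1)), toE0 V (n + 1) U = groupRep hR g := by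
  induction hg using Subgroup.closure_induction with
  | mem x hx =>
    obtain ⟨i, hi, rfl⟩ := hx
    have hi' : i < n := hi
    refine ⟨legs R (n + 1) i (by omega), incl_mem_unitaryIn _ _
      (lastLegs_mem_unitaryIn _ (hR.mem_unitaryIn b) i), ?_⟩
    rw [toE0_legs, groupRep_sigma]
  | one => exact ⟨1, one_mem _, by rw [map_one, map_one]⟩
  | mul x y _ _ hx hy =>
    obtain ⟨A, hA, hAx⟩ := hx
    obtain ⟨B, hB, hBy⟩ := hy
    exact ⟨A * B, mul_mem hA hB, by rw [map_mul, map_mul, hAx, hBy]⟩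
  | inv x _ hx =>
    obtain ⟨A, hA, hAx⟩ := hx
    obtain ⟨B, hB, -, hBA, -⟩ := exists_inverse_of_mem_unitaryIn hA
    refine ⟨B, hB, left_inv_eq_right_inv (a := groupRep hR x) ?_ ?_⟩
    · rw [← hAx, ← map_mul, hBA, map_one]
    · rw [← map_mul, mul_inv_cancel, map_one]

theorem toE0_comm_groupRep (hR : IsInvolutiveRMatrix R) {p s m : ℕ} (h : p ≤ s) (A : TEnd V p)
    {g : SInf} (hg : g ∈ windowSub s m) :
    toE0 V p A * groupRep hR g = groupRep hR g * toE0 V p A := by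
  change Commute _ _
  induction hg using Subgroup.closure_induction with
  | mem x hx =>
    obtain ⟨i, hi, rfl⟩ := hx
    rw [groupRep_sigma]
    exact toE0_comm_legsE0 R (h.trans hi.1) A
  | one =>
    rw [map_one]
    exact Commute.one_right _
  | mul x y _ _ hx hy =>
    rw [map_mul]
    exact hx.mul_right hy
  | inv x _ hx =>
    have h1 : groupRep hR x * groupRep hR x⁻¹ = 1 := by rw [← map_mul, mul_inv_cancel, map_one]
    have h2 : groupRep hR x⁻¹ * groupRep hR x = 1 := by rw [← map_mul, inv_mul_cancel, map_one]
    exact Commute.units_inv_right (u := ⟨groupRep hR x, groupRep hR x⁻¹, h1, h2⟩) hx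

variable [Nontrivial V]

theorem chi_eq (hR : IsInvolutiveRMatrix R) (g : SInf) : chi hR g = tau V (groupRep hR g) := by
  rw [chi, rho, MonoidAlgebra.lift_of]
  rfl

theorem chi_mul_comm (hR : IsInvolutiveRMatrix R) (g h : SInf) :
    chi hR (g * h) = chi hR (h * g) := by
  rw [chi_eq, chi_eq, map_mul (groupRep hR), map_mul (groupRep hR), tau_mul_comm]

/-- The image of `x` lies in `End(V^{⊗(n+1)})` and that of `y` in its commutant, so
`tau_mul_of_commute` applies. -/
theorem chi_mul_of_genSub_of_windowSub (hR : IsInvolutiveRMatrix R) {n s m : ℕ} (h : n + 1 ≤ s)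
    {x y : SInf} (hx : x ∈ genSub sigma n) (hy : y ∈ windowSub s m) :
    chi hR (x * y) = chi hR x * chi hR y := by
  obtain ⟨A, -, hA⟩ := exists_unitary_groupRep hR (stdOrthonormalBasis ℂ V) hx
  rw [chi_eq, chi_eq, chi_eq, map_mul, ← hA]
  exact tau_mul_of_commute V _ (fun A => toE0_comm_groupRep hR h A hy) A

theorem windowSub_le_genSub (s m : ℕ) : windowSub s m ≤ genSub sigma (s + m) :=
  Subgroup.closure_mono (Set.image_mono fun _ hi => hi.2)

open scoped ComplexOrder in
theorem chi_posDef (hR : IsInvolutiveRMatrix R) : IsPositiveDefinite (chi hR) := by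
  classical
  intro s a
  have hn : ∃ n, ∀ g ∈ s, g ∈ genSub sigma n := by
    choose f hf using mem_genSub_sigma
    exact ⟨s.sup f, fun g hg => genSub_mono sigma (Finset.le_sup hg) (hf g)⟩
  obtain ⟨n, hn⟩ := hn
  let b := stdOrthonormalBasis ℂ V
  let c := tensorBasis b.toBasis (n + 1)
  choose! U hU hUg using fun g hg => exists_unitary_groupRep hR b (hn g hg)
  let M : SInf → Matrix _ _ ℂ := fun g => LinearMap.toMatrixAlgEquiv c (U g)
  have key : ∀ g ∈ s, ∀ h ∈ s, chi hR (g⁻¹ * h) =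
      ((Module.finrank ℂ V : ℂ) ^ (n + 1))⁻¹ * (star (M g) * M h).trace := by
    intro g hg h hh
    obtain ⟨B, hB, -, hBA, hBs⟩ := exists_inverse_of_mem_unitaryIn (hU g hg)
    have e : groupRep hR g⁻¹ = toE0 V (n + 1) B := by
      refine (left_inv_eq_right_inv (a := groupRep hR g) ?_ ?_).symm
      · rw [← hUg g hg, ← map_mul, hBA, map_one]
      · rw [← map_mul, mul_inv_cancel, map_one]
    rw [chi_eq, map_mul, e, ← hUg h hh, ← map_mul, tau_toE0, normTrace, LinearMap.smul_apply,
      smul_eq_mul, LinearMap.trace_eq_matrix_trace ℂ c]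
    congr 2
    change LinearMap.toMatrixAlgEquiv c (B * U h) = _
    rw [map_mul, hBs]
  -- The quadratic form becomes the squared Hilbert-Schmidt norm of `X`, up to a positive factor.
  let X := ∑ g ∈ s, a g • M g
  have hX : ∑ g ∈ s, ∑ h ∈ s, star (a g) * a h * chi hR (g⁻¹ * h) =
      ((Module.finrank ℂ V : ℂ) ^ (n + 1))⁻¹ * (star X * X).trace := by
    simp only [X, star_sum, Finset.sum_mul, Finset.mul_sum, Matrix.trace_sum, star_smul]
    rw [Finset.sum_comm]
    refine Finset.sum_congr rfl fun h hh => ?_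
    refine Finset.sum_congr rfl fun g hg => ?_
    rw [key g hg h hh, Matrix.smul_mul, Matrix.mul_smul, Matrix.trace_smul, Matrix.trace_smul,
      smul_eq_mul, smul_eq_mul]
    ring
  have h0 : (0 : ℂ) ≤ (star X * X).trace :=
    (Matrix.posSemidef_conjTranspose_mul_self X).trace_nonneg
  obtain ⟨h1, h2⟩ := Complex.le_def.mp h0
  have e : ((Module.finrank ℂ V : ℂ) ^ (n + 1))⁻¹ =
      (((Module.finrank ℂ V : ℝ) ^ (n + 1))⁻¹ : ℝ) := by
    push_cast
    rfl
  rw [hX, e, Complex.re_ofReal_mul, Complex.im_ofReal_mul, ← h2]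
  exact ⟨mul_nonneg (by positivity) h1, by simp⟩

theorem chi_isCharacter (hR : IsInvolutiveRMatrix R) : IsCharacter (chi hR) where
  posDef := chi_posDef hR
  classFun g h := by rw [chi_mul_comm, ← mul_assoc, inv_mul_cancel, one_mul]
  map_one := by rw [chi_eq, map_one, tau_one]

theorem chi_isExtremalCharacter (hR : IsInvolutiveRMatrix R) : IsExtremalCharacter (chi hR) := by
  refine (chi_isCharacter hR).isExtremalCharacter fun g N => ?_
  obtain ⟨m, hm⟩ := mem_genSub_sigma g
  -- The `k`-th conjugate is moved to the window starting at `(k + 1)(m + 1)`. Windows have `m`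
  -- generators, hence `m + 1` points, so this spacing makes the supports disjoint; `k + 1` rather
  -- than `k` keeps the start above `m`.
  have hs : ∀ k : ℕ, m < (k + 1) * (m + 1) := fun k => by nlinarith
  choose k hk using fun i : ℕ => exists_conj_mem_windowSub (hs i) hm
  refine ⟨fun i => k i * g * (k i)⁻¹, fun i => ⟨k i, rfl⟩, fun i j hij => ?_⟩
  have sep : ∀ {i j : ℕ}, i < j → (i + 1) * (m + 1) + m + 1 ≤ (j + 1) * (m + 1) := by
    intro i j h
    nlinarith [Nat.mul_le_mul_right (m + 1) (show i + 1 + 1 ≤ j + 1 by omega)]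
  rcases lt_or_gt_of_ne (fun h => hij (Fin.ext h) : (i : ℕ) ≠ j) with h | h
  · exact chi_mul_of_genSub_of_windowSub hR (sep h)
      (windowSub_le_genSub _ _ (inv_mem (hk i))) (hk j)
  -- The factorization needs the lower window on the left; the trace property exchanges the factors.
  · rw [chi_mul_comm, mul_comm]
    exact chi_mul_of_genSub_of_windowSub hR (sep h)
      (windowSub_le_genSub _ _ (hk j)) (inv_mem (hk i))

theorem chi_eq_trace_of_isNCycle (hR : IsInvolutiveRMatrix R) {n : ℕ} (hn : 2 ≤ n) {c : SInf}
    (hc : IsNCycle n c) :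
    chi hR c = ((Module.finrank ℂ V : ℂ) ^ n)⁻¹ * LinearMap.trace ℂ (⨂[ℂ]^n V)
      (List.ofFn fun i : Fin (n - 1) => legs R n (i : ℕ) (by omega)).prod := by
  obtain ⟨k, rfl⟩ := (isNCycle_prod_sigma hn).exists_conj hc
  have e : groupRep hR ((List.range' 0 (n - 1)).map sigma).prod = toE0 V n
      (List.ofFn fun i : Fin (n - 1) => legs R n (i : ℕ) (by omega)).prod := by
    rw [map_list_prod, map_list_prod]
    congr 1
    refine List.ext_getElem (by simp) fun i h₁ h₂ => ?_
    simp [groupRep_sigma, toE0_legs]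
  rw [(chi_isCharacter hR).classFun, chi_eq, e, tau_toE0]
  rfl

end Chi

end YangBaxter

theorem mainTheorem5 {V : Type*} [NormedAddCommGroup V] [InnerProductSpace ℂ V]
    [FiniteDimensional ℂ V] [Nontrivial V] (R : Module.End ℂ (V ⊗[ℂ] V))
    (hR : YangBaxter.IsInvolutiveRMatrix R) :
    YangBaxter.IsExtremalCharacter (YangBaxter.chi hR) ∧
      ∀ n : ℕ, 2 ≤ n → ∀ c : YangBaxter.SInf, YangBaxter.IsNCycle n c →
        YangBaxter.chi hR c =
          ((Module.finrank ℂ V : ℂ) ^ n)⁻¹ *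
            LinearMap.trace ℂ (⨂[ℂ]^n V)
              (List.ofFn fun i : Fin (n - 1) =>
                YangBaxter.legs R n (i : ℕ) (by omega)).prod :=
  ⟨YangBaxter.chi_isExtremalCharacter hR, fun _ hn _ hc =>
    YangBaxter.chi_eq_trace_of_isNCycle hR hn hc⟩
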